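/- All logarithms are to base 2. Let $\mathcal U,\mathcal W,\dot{\mathcal W},\mathcal X,\mathcal Y,\mathcal Z$ be finite alphabets, $\alpha=|\mathcal U|$, $\omega=|\mathcal W|$, and let $Q_M(y|x)$ (main channel), $Q_W(z|y)$ (wiretap channel) and $Q_{\dot W|W}(\dot w|w)$ (leakage channel) be discrete memoryless channels; write $Q_{MW}$ for the cascade of $Q_M$ and $Q_W$, and $C_s=\max_{P_X}I(X;Y|Z)$, where $P_{XYZ}=P_X Q_M Q_W$. Let $k,m\ge 1$ and $\lambda=m/k$. A *system* consists of a stochastic encoder with a finite state set $\mathcal S^e$ of size $q_e$, and a deterministic decoder with a finite nonempty state set $\mathcal S^d$ of size $q_d$. A source sequence and a side-information sequence are cut into chunks $\tilde u_i\in\mathcal U^k$, $\tilde w_i\in\mathcal W^k$ ($i=0,1,\dots$). The encoder, started at a fixed state $s_0^e$, emits $\tilde x_i\in\mathcal X^m$ with probability $P(\tilde x_i|\tilde u_i,\tilde w_i,s_i^e)$ (independently for different $i$, given the inputs) and moves to $s^e_{i+1}=h(\tilde u_i,\tilde w_i,s^e_i)$. The decoder observes the output chunk $\tilde y_i\in\mathcal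 Y^m$ of $Q_M$, produces $\tilde v_i=f(\tilde y_i,\tilde w_i,s_i^d)\in\mathcal U^k$ and moves to $s^d_{i+1}=g(\tilde y_i,\tilde w_i,s_i^d)$. (An encoder without access to the side information is the special case in which $P$ and $h$ do not depend on $\tilde w$.) *Reliability.* For every chunk $(u_1,\dots,u_k)$, every side-information chunk $(w_1,\dots,w_k)$ and every pair of initial states of encoder and decoder, $\frac1k\sum_{i=1}^k\Pr\{V_i\neq u_i\}\le\epsilon_r$. *Security.* For every sufficiently large $n$ divisible by $k$, with $N=n\lambda$, $\max_\mu I_\mu(U^n;Z^N|\dot W^n)\le n\epsilon_s$, where the maximum is over all joint distributions $\mu(u^n,w^n)$, $\dot W^n$ is the output of the memoryless leakage channel fed by $W^n$, and $Z^N$ is the output of $Q_{MW}$ fed by the encoder output for $(U^n,W^n)$. *Conditional LZ complexity.* For $u^n\in\mathcal U^n$, $w^n\in\mathcal W^n$, parse the sequence of pairs $(u_1,w_1),\dots,(u_n,w_n)$ incrementally, each new phrase being the shortest string that is not an earlier phrase (the last phrase may be incomplete). Let $w(1),\dots,w(c(w^n))$ be the distinct $w$-components of the phrases and let $c_l(u^n|w^n)$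 be the number of distinct $u$-phrases that appear jointly with $w(l)$. Then $\rho_{LZ}(u^n|w^n)=\frac1n\sum_{l=1}^{c(w^n)}c_l(u^n|w^n)\log c_l(u^n|w^n)$. **Theorem.** There is a sequence $\epsilon_n<1$, $\epsilon_n\to0$, depending only on the source and side-information alphabets, such that the following holds. Let $\epsilon_s>0$ and $0<\epsilon_r\le 1-1/\alpha$. If a system with $q_e$ encoder states and $q_d$ decoder states satisfies the reliability and the security constraints, then for every $n\ge1$ divisible by $k$ and all $u^n\in\mathcal U^n$, $w^n\in\mathcal W^n$, $$\lambda\, C_s\ \ge\ \rho_{LZ}(u^n|w^n)-\Delta(\epsilon_r)-\epsilon_s-\eta_n(q_eq_d,k),$$ that is, when $C_s>0$, $$\lambda\ \ge\ \frac{\rho_{LZ}(u^n|w^n)-\Delta(\epsilon_r)-\epsilon_s-\eta_n(q_eq_d,k)}{C_s}.$$ Here $\Delta(\epsilon)=h_2(\epsilon)+\epsilon\log(\alpha-1)$, $h_2$ is the binary entropy function, $$\eta_n(q_eq_d,k)=\min_{\ell\,\mid\,n/k}\left[\frac{\log(q_eq_d)+1}{k\ell}+\frac{\log(4A^2)}{(1-\epsilon_n)\log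 n}+\frac{A^2\log(4A^2)}{n}\right],\qquad A=\frac{(\alpha\omega)^{k\ell+1}-1}{\alpha\omega-1}$$ (for $n=1$, where $\log n=0$, the middle term is read as $0$). The bound does not involve the leakage channel $Q_{\dot W|W}$. -/

import Mathlib

open Filter Topology

noncomputable section

namespace WiretapSI

/-! ### Information measures on finite alphabets (all logarithms are to base 2) -/

/-- A discrete channel: a conditional probability distribution `prob a b = P(b | a)`. -/
structure Channel (A B : Type*) [Fintype B] where
  prob : A → B → ℝ
  nonneg : ∀ a b, 0 ≤ prob a b
  sum_one : ∀ a, ∑ b, prob a b = 1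

/-- Shannon entropy in bits. -/
def entropy {A : Type*} [Fintype A] (p : A → ℝ) : ℝ :=
  (∑ a, Real.negMulLog (p a)) / Real.log 2

/-- Conditional mutual information `I(A;B|C) = H(A,C) + H(B,C) - H(A,B,C) - H(C)`, in bits,
of a joint distribution of `(A, B, C)`. -/
def condMutualInfo {A B C : Type*} [Fintype A] [Fintype B] [Fintype C] (p : A × B × C → ℝ) : ℝ :=
  entropy (fun ac : A × C => ∑ b, p (ac.1, b, ac.2))
    + entropy (fun bc : B × C => ∑ a, p (a, bc.1, bc.2))
    - entropy p
    - entropy (fun c : C => ∑ a, ∑ b, p (a, b, c))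

/-- Memoryless extension of a transition law to sequences indexed by `ι`. -/
def memoryless {ι A B : Type*} [Fintype ι] (Q : A → B → ℝ) (x : ι → A) (y : ι → B) : ℝ :=
  ∏ i, Q (x i) (y i)

/-- The cascade `Q_MW(z|x) = ∑ y, Q_M(y|x) Q_W(z|y)`. -/
def cascade {X Y Z : Type*} [Fintype Y] [Fintype Z] (QM : Channel X Y) (QW : Channel Y Z)
    (x : X) (z : Z) : ℝ :=
  ∑ y, QM.prob x y * QW.prob y z

/-- The secrecy capacity `C_s = max_{P_X} I(X;Y|Z)` of the degraded wiretap channel, where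
`P_{XYZ}(x,y,z) = P_X(x) Q_M(y|x) Q_W(z|y)`. -/
def secrecyCapacity {X Y Z : Type*} [Fintype X] [Fintype Y] [Fintype Z]
    (QM : Channel X Y) (QW : Channel Y Z) : ℝ :=
  sSup ((fun P : X → ℝ =>
      condMutualInfo (fun t : X × Y × Z => P t.1 * QM.prob t.1 t.2.1 * QW.prob t.2.1 t.2.2)) ''
    stdSimplex ℝ X)

/-! ### Finite-state communication systems with side information -/

/-- A stochastic finite-state encoder (with its fixed initial state) and a deterministic
finite-state decoder. In each time unit a chunk of `k` source symbols is encoded into `m` channel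
inputs; the matching chunk of `k` side-information symbols is available to both terminals. -/
structure System (U W X Y Se Sd : Type*) [Fintype X] (k m : ℕ) where
  /-- `P(x | u, w, s)`. -/
  enc : Channel ((Fin k → U) × (Fin k → W) × Se) (Fin m → X)
  /-- Next-state function `h` of the encoder. -/
  encNext : (Fin k → U) → (Fin k → W) → Se → Se
  /-- Initial state of the encoder. -/
  encInit : Se
  /-- Output function `f` of the decoder. -/
  dec : (Fin m → Y) → (Fin k → W) → Sd → (Fin k → U)
  /-- Next-state function `g` of the decoder. -/
  decNext : (Fin m → Y) → (Fin k → W) → Sd → Sd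

namespace System

variable {U W X Y Z Wd Se Sd : Type*} [Fintype X] {k m : ℕ}

/-- The state of the encoder before chunk `i`, for `b` input chunks
`u = (u_0, …, u_{b-1})`, `w = (w_0, …, w_{b-1})`. -/
def encState (S : System U W X Y Se Sd k m) {b : ℕ} (u : Fin b → Fin k → U)
    (w : Fin b → Fin k → W) : ℕ → Se
  | 0 => S.encInit
  | i + 1 => if h : i < b then S.encNext (u ⟨i, h⟩) (w ⟨i, h⟩) (S.encState u w i)
      else S.encState u w i

/-- `P(x^N | u^n, w^n)` for `n = b k`, `N = b m`; sequences are written as `b` chunks. -/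
def encLaw (S : System U W X Y Se Sd k m) {b : ℕ} (u : Fin b → Fin k → U)
    (w : Fin b → Fin k → W) (x : Fin b → Fin m → X) : ℝ :=
  ∏ i, S.enc.prob (u i, w i, S.encState u w i) (x i)

/-- `P(z^N | u^n, w^n)`: the law of the wiretapper's channel output. -/
def wiretapLaw [Fintype Y] [Fintype Z] (S : System U W X Y Se Sd k m)
    (QM : Channel X Y) (QW : Channel Y Z) {b : ℕ} (u : Fin b → Fin k → U)
    (w : Fin b → Fin k → W) (z : Fin b → Fin m → Z) : ℝ :=
  ∑ x, S.encLaw u w x * memoryless (memoryless (cascade QM QW)) x z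

/-- The joint law of `(U^n, Z^N, Ẇ^n)` when `(U^n, W^n)` has law `μ` and `Ẇ^n` is the output of the
memoryless channel `QL` (the leakage channel) with input `W^n`. -/
def jointLaw [Fintype W] [Fintype Y] [Fintype Z] [Fintype Wd] (S : System U W X Y Se Sd k m)
    (QM : Channel X Y) (QW : Channel Y Z) (QL : Channel W Wd) {b : ℕ}
    (μ : (Fin b → Fin k → U) × (Fin b → Fin k → W) → ℝ)
    (t : (Fin b → Fin k → U) × (Fin b → Fin m → Z) × (Fin b → Fin k → Wd)) : ℝ :=
  ∑ w, μ (t.1, w) * memoryless (memoryless QL.prob) w t.2.2 * S.wiretapLaw QM QW t.1 w t.2.1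

/-- The security constraint: for every sufficiently large `n = b k`,
`max_μ I_μ(U^n; Z^N | Ẇ^n) ≤ n ε_s`. -/
def Secure [Fintype U] [Fintype W] [Fintype Y] [Fintype Z] [Fintype Wd]
    (S : System U W X Y Se Sd k m) (QM : Channel X Y) (QW : Channel Y Z) (QL : Channel W Wd)
    (εs : ℝ) : Prop :=
  ∀ᶠ b : ℕ in atTop, ∀ μ ∈ stdSimplex ℝ ((Fin b → Fin k → U) × (Fin b → Fin k → W)),
    condMutualInfo (S.jointLaw QM QW QL μ) ≤ ((b * k : ℕ) : ℝ) * εs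

/-- The bit error probability `(1/k) ∑ j, Pr{V_j ≠ u_j}` of a chunk `u` with side information `w`,
when the encoder starts in state `s` and the decoder in state `d`. -/
def bitErrorProb [DecidableEq U] [Fintype Y] (S : System U W X Y Se Sd k m) (QM : Channel X Y)
    (u : Fin k → U) (w : Fin k → W) (s : Se) (d : Sd) : ℝ :=
  (1 / (k : ℝ)) * ∑ j : Fin k, ∑ x : Fin m → X, ∑ y : Fin m → Y,
    if S.dec y w d j ≠ u j then S.enc.prob (u, w, s) x * memoryless QM.prob x y else 0

/-- The reliability constraint: the bit error probability is at most `ε_r` for every chunk and every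
combination of initial states of the encoder and the decoder. -/
def Reliable [DecidableEq U] [Fintype Y] (S : System U W X Y Se Sd k m) (QM : Channel X Y)
    (εr : ℝ) : Prop :=
  ∀ (u : Fin k → U) (w : Fin k → W) (s : Se) (d : Sd), S.bitErrorProb QM u w s d ≤ εr

end System

/-! ### Conditional Lempel–Ziv complexity -/

/-- One step of incremental parsing. The state is the list of completed phrases and the current
unfinished phrase; the current phrase is completed once it differs from all earlier phrases. -/
def lzStep {A : Type*} [DecidableEq A] (st : List (List A) × List A) (a : A) :
    List (List A) × List A :=
  if st.2 ++ [a] ∈ st.1 then (st.1, st.2 ++ [a]) else (st.1 ++ [st.2 ++ [a]], [])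

/-- The phrases of the incremental parsing, including a possibly incomplete last one. -/
def lzParse {A : Type*} [DecidableEq A] (l : List A) : List (List A) :=
  let st := l.foldl lzStep ([], [])
  if st.2 = [] then st.1 else st.1 ++ [st.2]

section LZ

variable {U W : Type*} [DecidableEq U] [DecidableEq W] {n : ℕ}

/-- The distinct phrases of the incremental parsing of `((u_1,w_1), …, (u_n,w_n))`. -/
def jointPhrases (u : Fin n → U) (w : Fin n → W) : Finset (List (U × W)) :=
  (lzParse (List.ofFn fun i => (u i, w i))).toFinset

/-- The distinct `w`-phrases. -/
def sidePhrases (u : Fin n → U) (w : Fin n → W) : Finset (List W) :=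
  (jointPhrases u w).image (List.map Prod.snd)

/-- The number `c_l(u^n|w^n)` of distinct `u`-phrases that appear jointly with the `w`-phrase `v`. -/
def condCount (u : Fin n → U) (w : Fin n → W) (v : List W) : ℕ :=
  (((jointPhrases u w).filter fun p => p.map Prod.snd = v).image (List.map Prod.fst)).card

/-- The conditional LZ complexity `ρ_LZ(u^n|w^n)`. -/
def condLZ (u : Fin n → U) (w : Fin n → W) : ℝ :=
  (1 / (n : ℝ)) * ∑ v ∈ sidePhrases u w, (condCount u w v : ℝ) * Real.logb 2 (condCount u w v)

end LZ

/-! ### The terms of the bound -/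

/-- `Δ(ε) = h₂(ε) + ε log (α - 1)`. -/
def fanoTerm (α : ℕ) (ε : ℝ) : ℝ :=
  Real.binEntropy ε / Real.log 2 + ε * Real.logb 2 ((α : ℝ) - 1)

/-- `A = ((αω)^(kℓ+1) - 1) / (αω - 1)`. -/
def numStrings (α ω k ℓ : ℕ) : ℝ :=
  (((α : ℝ) * ω) ^ (k * ℓ + 1) - 1) / ((α : ℝ) * ω - 1)

/-- The expression that is minimized over `ℓ` (with `q = q_e q_d`, and `e` the value of `ε_n`). -/
def redundancyTerm (α ω : ℕ) (e : ℝ) (n q k ℓ : ℕ) : ℝ :=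
  (Real.logb 2 q + 1) / ((k : ℝ) * ℓ)
    + Real.logb 2 (4 * numStrings α ω k ℓ ^ 2) / ((1 - e) * Real.logb 2 n)
    + numStrings α ω k ℓ ^ 2 * Real.logb 2 (4 * numStrings α ω k ℓ ^ 2) / n

/-- `η_n(q, k)`: the minimum of `redundancyTerm` over the divisors `ℓ` of `n / k`. -/
def redundancy (α ω : ℕ) (e : ℝ) (n q k : ℕ) : ℝ :=
  sInf (redundancyTerm α ω e n q k '' {ℓ : ℕ | ℓ ∣ n / k})

end WiretapSI

end

open WiretapSI

/-! The security constraint ranges over all joint laws of source and side information, so it may be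
tested on a source chosen for the purpose: `U^n` uniform and `W^n` constant. This already forces `λ
C_s ≥ log α - Δ(ε_r) - ε_s` (`System.logb_card_le`). No individual sequence is more complex than
that, since `ρ_LZ ≤ log α` (`condLZ_le_logb_card`), and `η_n ≥ 0` for the choice `ε_n = 0`
(`redundancy_nonneg`). The theorem is the sum of these three inequalities; the state counts and the
details of the parsing play no further part.

The first inequality is a converse for the degraded wiretap channel, `H(U) + E log K(U|Y) ≤ I(U;Z) +
N C_s` for every positive sub-probability kernel `K` (`wiretap_converse`). It is obtained by a
single use of Gibbs' inequality, comparing the true law of `(U,X,Y,Z)` with a suitable measure of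
mass at most 1, instead of by chain rules for entropies.

For `K`, each source letter is guessed through a symmetric channel centred at the decoded letter.
Then `-log K` is affine in the number of letter errors, and the reliability constraint gives `E log
K ≥ -n Δ(ε_r)` (`System.fano_le`). The security constraint bounds `I(U;Z)` by `n ε_s`, because
constant side information makes the leakage output independent of `(U,Z)`. -/

namespace WiretapSI

/-! ### Conditional LZ complexity never exceeds `log α`. -/

section LZBound

theorem sum_length_foldl_lzStep {A : Type*} [DecidableEq A] (l : List A)
    (st : List (List A) × List A) :
    ((l.foldl lzStep st).1.map List.length).sum + (l.foldl lzStep st).2.length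
      = (st.1.map List.length).sum + st.2.length + l.length := by
  induction l generalizing st with
  | nil => simp
  | cons a l ih =>
    rw [List.foldl_cons, ih]
    unfold lzStep
    split_ifs <;> simp <;> omega

theorem sum_length_lzParse {A : Type*} [DecidableEq A] (l : List A) :
    ((lzParse l).map List.length).sum = l.length := by
  have h := sum_length_foldl_lzStep l ([], [])
  simp only [List.map_nil, List.sum_nil, List.length_nil, zero_add] at h
  unfold lzParse
  dsimp only
  split_ifs with h2
  · simpa [h2] using h
  · simpa using h

theorem sum_toFinset_le_sum_map {A : Type*} [DecidableEq A] (f : A → ℕ) (l : List A) :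
    ∑ a ∈ l.toFinset, f a ≤ (l.map f).sum := by
  induction l with
  | nil => simp
  | cons a l ih =>
    rw [List.toFinset_cons, List.map_cons, List.sum_cons]
    by_cases h : a ∈ l.toFinset
    · rw [Finset.insert_eq_of_mem h]; omega
    · rw [Finset.sum_insert h]; omega

variable {U W : Type*} [DecidableEq U] [DecidableEq W] {n : ℕ}

/-- Equality can fail: the incomplete last phrase may repeat an earlier one, and the finset counts
it once. -/
theorem sum_length_jointPhrases_le (u : Fin n → U) (w : Fin n → W) :
    ∑ p ∈ jointPhrases u w, p.length ≤ n := by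
  refine (sum_toFinset_le_sum_map List.length _).trans ?_
  rw [sum_length_lzParse, List.length_ofFn]

theorem condCount_le_card_filter (u : Fin n → U) (w : Fin n → W) (v : List W) :
    condCount u w v ≤ ((jointPhrases u w).filter fun p => p.map Prod.snd = v).card :=
  Finset.card_image_le

/-- A phrase of pairs with side component `v` has a source component of the same length, so the
words over the source alphabet of length `|v|` bound the count. -/
theorem condCount_le_pow [Fintype U] (u : Fin n → U) (w : Fin n → W) (v : List W) :
    condCount u w v ≤ Fintype.card U ^ v.length := by
  rw [← card_vector (α := U) v.length, ← Finset.card_univ]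
  unfold condCount
  refine (Finset.card_le_card (t := Finset.univ.image
    (fun x : List.Vector U v.length => x.toList)) ?_).trans Finset.card_image_le
  intro x hx
  simp only [Finset.mem_image, Finset.mem_filter] at hx
  obtain ⟨p, ⟨-, hp⟩, rfl⟩ := hx
  refine Finset.mem_image.2 ⟨⟨p.map Prod.fst, ?_⟩, Finset.mem_univ _, rfl⟩
  rw [← hp]; simp

/-- The conditional LZ complexity is at most the logarithm of the alphabet size. -/
theorem condLZ_le_logb_card [Fintype U] (hn : 0 < n) (u : Fin n → U) (w : Fin n → W) :
    condLZ u w ≤ Real.logb 2 (Fintype.card U) := by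
  have hU : 0 < Fintype.card U := Fintype.card_pos_iff.2 ⟨u ⟨0, hn⟩⟩
  have hU1 : (1 : ℝ) ≤ Fintype.card U := by exact_mod_cast hU
  have hlog : 0 ≤ Real.logb 2 (Fintype.card U) := Real.logb_nonneg one_lt_two hU1
  have hn' : (0 : ℝ) < n := by exact_mod_cast hn
  have key : ∑ v ∈ sidePhrases u w, (condCount u w v : ℝ) * Real.logb 2 (condCount u w v)
      ≤ n * Real.logb 2 (Fintype.card U) := by
    -- One factor `c_l` is bounded by the number of phrases over `v`, and its logarithm by `|v| log
    -- α`. Each phrase is thus charged its own length times `log α`, and the lengths add up to at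
    -- most `n`.
    calc _ ≤ ∑ v ∈ sidePhrases u w,
          ((((jointPhrases u w).filter fun p => p.map Prod.snd = v).card * v.length : ℕ) : ℝ)
            * Real.logb 2 (Fintype.card U) := by
          refine Finset.sum_le_sum fun v _ => ?_
          rcases Nat.eq_zero_or_pos (condCount u w v) with h0 | h0
          · rw [h0]; simp; positivity
          · have h1 : Real.logb 2 (condCount u w v)
                ≤ v.length * Real.logb 2 (Fintype.card U) := by
              rw [← Real.logb_pow]
              refine Real.logb_le_logb_of_le one_lt_two (by exact_mod_cast h0) ?_
              exact_mod_cast condCount_le_pow u w v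
            have h2 : (condCount u w v : ℝ)
                ≤ ((jointPhrases u w).filter fun p => p.map Prod.snd = v).card := by
              exact_mod_cast condCount_le_card_filter u w v
            rw [Nat.cast_mul, mul_assoc]
            exact mul_le_mul h2 h1
              (Real.logb_nonneg one_lt_two (by exact_mod_cast h0)) (by positivity)
      _ ≤ _ := by
          rw [← Finset.sum_mul]
          refine mul_le_mul_of_nonneg_right ?_ hlog
          rw [← Nat.cast_sum]
          refine Nat.cast_le.2 (le_trans (le_of_eq ?_) (sum_length_jointPhrases_le u w))
          rw [← Finset.sum_fiberwise_of_maps_to (s := jointPhrases u w) (t := sidePhrases u w)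
            (g := List.map Prod.snd) (fun p hp => Finset.mem_image_of_mem _ hp)]
          refine Finset.sum_congr rfl fun v _ => ?_
          rw [← smul_eq_mul, ← Finset.sum_const]
          refine Finset.sum_congr rfl fun p hp => ?_
          rw [← (Finset.mem_filter.1 hp).2, List.length_map]
  unfold condLZ
  rw [one_div, inv_mul_le_iff₀ hn']
  exact key

end LZBound

/-! ### Nonnegativity of the redundancy term. -/

theorem one_le_numStrings {α ω : ℕ} (h : 2 ≤ α * ω) (k ℓ : ℕ) : 1 ≤ numStrings α ω k ℓ := by
  have h2 : (2 : ℝ) ≤ (α : ℝ) * ω := by exact_mod_cast h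
  unfold numStrings
  rw [le_div_iff₀ (by linarith), one_mul]
  have := le_self_pow₀ (a := (α : ℝ) * ω) (by linarith) (Nat.succ_ne_zero (k * ℓ))
  simpa using this

theorem redundancy_nonneg {α ω : ℕ} (h : 2 ≤ α * ω) (n q k : ℕ) :
    0 ≤ redundancy α ω 0 n q k := by
  refine Real.sInf_nonneg ?_
  rintro _ ⟨ℓ, -, rfl⟩
  have hA := one_le_numStrings h k ℓ
  have h4 : 0 ≤ Real.logb 2 (4 * numStrings α ω k ℓ ^ 2) :=
    Real.logb_nonneg one_lt_two (by nlinarith)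
  -- Covers `a = 0` too, where the logarithm is `0` by convention. Zero denominators, such as `log
  -- n` at `n = 1`, make their quotient `0`, so nonnegativity survives.
  have hnat : ∀ a : ℕ, 0 ≤ Real.logb 2 (a : ℝ) := fun a =>
    div_nonneg (Real.log_natCast_nonneg a) (Real.log_nonneg one_le_two)
  have hq := hnat q
  have hn := hnat n
  unfold redundancyTerm
  rw [sub_zero, one_mul]
  positivity

end WiretapSI

/-! ### Gibbs' inequality, mutual information, and averages over product laws. -/

namespace WiretapSI

section Information

/-- Gibbs' inequality for unnormalized finite measures. -/
theorem sum_mul_log_sub_log_le {T : Type*} [Fintype T] (P N : T → ℝ) (hP : ∀ t, 0 ≤ P t)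
    (hN : ∀ t, 0 ≤ N t) (hPN : ∀ t, 0 < P t → 0 < N t) :
    ∑ t, P t * (Real.log (N t) - Real.log (P t)) ≤ ∑ t, N t - ∑ t, P t := by
  rw [← Finset.sum_sub_distrib]
  refine Finset.sum_le_sum fun t _ => ?_
  rcases (hP t).eq_or_lt with h | h
  · rw [← h]; simpa using hN t
  · rw [← Real.log_div (hPN t h).ne' h.ne']
    have := Real.log_le_sub_one_of_pos (div_pos (hPN t h) h)
    calc P t * Real.log (N t / P t) ≤ P t * (N t / P t - 1) := by gcongr
      _ = _ := by field_simp

/-- Conditional mutual information as an expected log-likelihood ratio. -/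
theorem condMutualInfo_mul_log_two {A B C : Type*} [Fintype A] [Fintype B] [Fintype C]
    (p : A × B × C → ℝ) :
    condMutualInfo p * Real.log 2 = ∑ a, ∑ b, ∑ c, p (a, b, c) *
      (Real.log (p (a, b, c)) + Real.log (∑ a', ∑ b', p (a', b', c))
        - Real.log (∑ b', p (a, b', c)) - Real.log (∑ a', p (a', b, c))) := by
  have h2 : Real.log 2 ≠ 0 := (Real.log_pos one_lt_two).ne'
  have e1 : ∑ ac : A × C, Real.negMulLog (∑ b, p (ac.1, b, ac.2))
      = -∑ a, ∑ b, ∑ c, p (a, b, c) * Real.log (∑ b', p (a, b', c)) := by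
    rw [Fintype.sum_prod_type, ← Finset.sum_neg_distrib]
    refine Finset.sum_congr rfl fun a _ => ?_
    rw [Finset.sum_comm (s := (Finset.univ : Finset B)), ← Finset.sum_neg_distrib]
    refine Finset.sum_congr rfl fun c _ => ?_
    rw [← Finset.sum_mul, Real.negMulLog, neg_mul]
  have e2 : ∑ bc : B × C, Real.negMulLog (∑ a, p (a, bc.1, bc.2))
      = -∑ a, ∑ b, ∑ c, p (a, b, c) * Real.log (∑ a', p (a', b, c)) := by
    rw [Fintype.sum_prod_type, Finset.sum_comm (s := (Finset.univ : Finset A)),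
      ← Finset.sum_neg_distrib]
    refine Finset.sum_congr rfl fun b _ => ?_
    rw [Finset.sum_comm, ← Finset.sum_neg_distrib]
    refine Finset.sum_congr rfl fun c _ => ?_
    rw [← Finset.sum_mul, Real.negMulLog, neg_mul]
  have e3 : ∑ t : A × B × C, Real.negMulLog (p t)
      = -∑ a, ∑ b, ∑ c, p (a, b, c) * Real.log (p (a, b, c)) := by
    simp only [Fintype.sum_prod_type, Real.negMulLog, neg_mul, Finset.sum_neg_distrib]
  have e4 : ∑ c : C, Real.negMulLog (∑ a, ∑ b, p (a, b, c))
      = -∑ a, ∑ b, ∑ c, p (a, b, c) * Real.log (∑ a', ∑ b', p (a', b', c)) := by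
    have : ∀ a, ∑ b, ∑ c, p (a, b, c) * Real.log (∑ a', ∑ b', p (a', b', c))
        = ∑ c, (∑ b, p (a, b, c)) * Real.log (∑ a', ∑ b', p (a', b', c)) := fun a => by
      rw [Finset.sum_comm]
      exact Finset.sum_congr rfl fun c _ => by rw [Finset.sum_mul]
    simp only [this]
    rw [Finset.sum_comm, ← Finset.sum_neg_distrib]
    refine Finset.sum_congr rfl fun c _ => ?_
    rw [← Finset.sum_mul, Real.negMulLog, neg_mul]
  simp only [mul_sub, mul_add, Finset.sum_sub_distrib, Finset.sum_add_distrib]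
  unfold condMutualInfo entropy
  rw [e1, e2, e3, e4]
  field_simp
  ring

/-- Entropy is continuous and the simplex is compact. Without boundedness the supremum defining the
capacity would be the default value `0`. -/
theorem bddAbove_condMutualInfo {X Y Z : Type*} [Fintype X] [Fintype Y] [Fintype Z]
    (QM : Channel X Y) (QW : Channel Y Z) :
    BddAbove ((fun P : X → ℝ =>
      condMutualInfo (fun t : X × Y × Z => P t.1 * QM.prob t.1 t.2.1 * QW.prob t.2.1 t.2.2)) ''
    stdSimplex ℝ X) := by
  refine (isCompact_stdSimplex ℝ X).bddAbove_image (Continuous.continuousOn ?_)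
  unfold condMutualInfo entropy
  have := Real.continuous_negMulLog
  fun_prop

theorem condMutualInfo_le_secrecyCapacity {X Y Z : Type*} [Fintype X] [Fintype Y] [Fintype Z]
    (QM : Channel X Y) (QW : Channel Y Z) {P : X → ℝ} (hP : P ∈ stdSimplex ℝ X) :
    condMutualInfo (fun t : X × Y × Z => P t.1 * QM.prob t.1 t.2.1 * QW.prob t.2.1 t.2.2)
      ≤ secrecyCapacity QM QW :=
  le_csSup (bddAbove_condMutualInfo QM QW) ⟨P, hP, rfl⟩

/-- Resampling one coordinate of a family of independent variables preserves expectations. -/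
theorem sum_prod_mul_resample {ι B : Type*} [Fintype ι] [DecidableEq ι] [Fintype B]
    (p : ι → B → ℝ) (hp : ∀ i, ∑ b, p i b = 1) (i : ι) (F : (ι → B) → ℝ) :
    ∑ y : ι → B, (∏ j, p j (y j)) * ∑ c, p i c * F (Function.update y i c)
      = ∑ y : ι → B, (∏ j, p j (y j)) * F y := by
  -- Exchanging `y i` with an independent copy `c` of the same law is an involution that preserves
  -- the joint weight.
  have hinv : Function.Involutive
      (fun t : (ι → B) × B => (Function.update t.1 i t.2, t.1 i)) := by
    rintro ⟨y, c⟩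
    simp
  have h1 : ∑ t : (ι → B) × B, (∏ j, p j (t.1 j)) * (p i t.2 * F (Function.update t.1 i t.2))
      = ∑ t : (ι → B) × B, (∏ j, p j (t.1 j)) * (p i t.2 * F t.1) := by
    rw [← Equiv.sum_comp hinv.toPerm]
    refine Finset.sum_congr rfl fun t _ => ?_
    simp only [Function.Involutive.coe_toPerm, Function.update_idem, Function.update_eq_self]
    rw [← mul_assoc, ← mul_assoc]
    congr 1
    rw [← Finset.mul_prod_erase _ _ (Finset.mem_univ i),
      ← Finset.mul_prod_erase _ (fun j => p j (t.1 j)) (Finset.mem_univ i)]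
    have : ∏ j ∈ Finset.univ.erase i, p j (Function.update t.1 i t.2 j)
        = ∏ j ∈ Finset.univ.erase i, p j (t.1 j) :=
      Finset.prod_congr rfl fun j hj => by
        rw [Function.update_of_ne (Finset.ne_of_mem_erase hj)]
    rw [this, Function.update_self]
    ring
  rw [Fintype.sum_prod_type, Fintype.sum_prod_type] at h1
  simp only [Finset.mul_sum]
  rw [h1]
  refine Finset.sum_congr rfl fun y _ => ?_
  dsimp only
  rw [← Finset.mul_sum, ← Finset.sum_mul, hp, one_mul]

theorem sum_prod_eq_one {ι B : Type*} [Fintype ι] [DecidableEq ι] [Fintype B]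
    (p : ι → B → ℝ) (hp : ∀ i, ∑ b, p i b = 1) : ∑ y : ι → B, ∏ j, p j (y j) = 1 := by
  rw [← Fintype.prod_sum]
  simp [hp]

/-- The marginal of one coordinate of a family of independent variables. -/
theorem sum_prod_mul_apply {ι B : Type*} [Fintype ι] [DecidableEq ι] [Fintype B]
    (p : ι → B → ℝ) (hp : ∀ i, ∑ b, p i b = 1) (i : ι) (φ : B → ℝ) :
    ∑ y : ι → B, (∏ j, p j (y j)) * φ (y i) = ∑ c, p i c * φ c := by
  rw [← sum_prod_mul_resample p hp i]
  simp only [Function.update_self]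
  rw [← Finset.sum_mul, sum_prod_eq_one p hp, one_mul]

/-- A bound on the conditional mean given all other coordinates is a bound on the mean. It serves
where `F` depends on coordinate `i` and also on the past, as decoding errors do through the decoder
state. -/
theorem sum_prod_mul_le {ι B : Type*} [Fintype ι] [DecidableEq ι] [Fintype B]
    (p : ι → B → ℝ) (hp0 : ∀ i b, 0 ≤ p i b) (hp : ∀ i, ∑ b, p i b = 1) (i : ι)
    (F : (ι → B) → ℝ) (C : ℝ) (hF : ∀ y, ∑ c, p i c * F (Function.update y i c) ≤ C) :
    ∑ y : ι → B, (∏ j, p j (y j)) * F y ≤ C := by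
  rw [← sum_prod_mul_resample p hp i]
  calc _ ≤ ∑ y : ι → B, (∏ j, p j (y j)) * C := by
        refine Finset.sum_le_sum fun y _ => mul_le_mul_of_nonneg_left (hF y) ?_
        exact Finset.prod_nonneg fun j _ => hp0 _ _
    _ = C := by rw [← Finset.sum_mul, sum_prod_eq_one p hp, one_mul]

end Information

end WiretapSI

/-! ### The converse for the degraded wiretap channel. -/

namespace WiretapSI

noncomputable section Converse

set_option linter.unusedSectionVars false

variable {A ι X Y Z : Type*} [Fintype A] [Fintype ι] [DecidableEq ι] [Fintype X] [Fintype Y]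
  [Fintype Z]

theorem cascade_nonneg (QM : Channel X Y) (QW : Channel Y Z) (x : X) (z : Z) :
    0 ≤ cascade QM QW x z :=
  Finset.sum_nonneg fun y _ => mul_nonneg (QM.nonneg x y) (QW.nonneg y z)

theorem sum_cascade (QM : Channel X Y) (QW : Channel Y Z) (x : X) :
    ∑ z, cascade QM QW x z = 1 := by
  unfold cascade
  rw [Finset.sum_comm]
  simp only [← Finset.mul_sum, QW.sum_one, mul_one, QM.sum_one]

theorem cascade_pos (QM : Channel X Y) (QW : Channel Y Z) {x : X} {y : Y} {z : Z}
    (hM : 0 < QM.prob x y) (hW : 0 < QW.prob y z) : 0 < cascade QM QW x z :=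
  Finset.sum_pos' (fun y _ => mul_nonneg (QM.nonneg x y) (QW.nonneg y z))
    ⟨y, Finset.mem_univ y, mul_pos hM hW⟩

theorem memoryless_nonneg {X Y : Type*} {Q : X → Y → ℝ} (hQ : ∀ a b, 0 ≤ Q a b) (x : ι → X)
    (y : ι → Y) : 0 ≤ memoryless Q x y :=
  Finset.prod_nonneg fun _ _ => hQ _ _

theorem sum_memoryless {X Y : Type*} [Fintype Y] {Q : X → Y → ℝ} (hQ : ∀ a, ∑ b, Q a b = 1)
    (x : ι → X) : ∑ y, memoryless Q x y = 1 :=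
  sum_prod_eq_one (fun i => Q (x i)) fun i => hQ (x i)

theorem sum_memoryless_mul_apply {X Y : Type*} [Fintype Y] {Q : X → Y → ℝ}
    (hQ : ∀ a, ∑ b, Q a b = 1) (x : ι → X) (i : ι) (φ : Y → ℝ) :
    ∑ y, memoryless Q x y * φ (y i) = ∑ b, Q (x i) b * φ b :=
  sum_prod_mul_apply (fun i => Q (x i)) (fun i => hQ (x i)) i φ

theorem sum_memoryless_mul_memoryless (QM : Channel X Y) (QW : Channel Y Z) (x : ι → X)
    (z : ι → Z) : ∑ y, memoryless QM.prob x y * memoryless QW.prob y z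
      = memoryless (cascade QM QW) x z := by
  unfold memoryless cascade
  rw [Fintype.prod_sum]
  simp only [Finset.prod_mul_distrib]

/-- The single-letter conditional law `P(y | z)` for the input law `P`. -/
def backwardLaw (QM : Channel X Y) (QW : Channel Y Z) (P : X → ℝ) (y : Y) (z : Z) : ℝ :=
  (∑ a, P a * QM.prob a y * QW.prob y z) / ∑ b, ∑ a, P a * QM.prob a b * QW.prob b z

theorem backwardLaw_nonneg (QM : Channel X Y) (QW : Channel Y Z) {P : X → ℝ}
    (hP : ∀ a, 0 ≤ P a) (y : Y) (z : Z) : 0 ≤ backwardLaw QM QW P y z := by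
  have : ∀ b, 0 ≤ ∑ a, P a * QM.prob a b * QW.prob b z := fun b =>
    Finset.sum_nonneg fun a _ =>
      mul_nonneg (mul_nonneg (hP a) (QM.nonneg a b)) (QW.nonneg b z)
  exact div_nonneg (this y) (Finset.sum_nonneg fun b _ => this b)

/-- Only `≤`: if `z` has probability zero, the quotients are all `0` and so is their sum. Mass at
most 1 is all that Gibbs' inequality needs. -/
theorem sum_backwardLaw_le_one (QM : Channel X Y) (QW : Channel Y Z) (P : X → ℝ) (z : Z) :
    ∑ y, backwardLaw QM QW P y z ≤ 1 := by
  unfold backwardLaw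
  rw [← Finset.sum_div]
  exact div_self_le_one _

theorem backward_num_pos (QM : Channel X Y) (QW : Channel Y Z) {P : X → ℝ}
    (hP : ∀ a, 0 ≤ P a) {x : X} {y : Y} {z : Z} (hx : 0 < P x) (hM : 0 < QM.prob x y)
    (hW : 0 < QW.prob y z) : 0 < ∑ a, P a * QM.prob a y * QW.prob y z :=
  Finset.sum_pos' (fun a _ => mul_nonneg (mul_nonneg (hP a) (QM.nonneg a y)) (QW.nonneg y z))
    ⟨x, Finset.mem_univ x, by positivity⟩

theorem backward_den_pos (QM : Channel X Y) (QW : Channel Y Z) {P : X → ℝ}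
    (hP : ∀ a, 0 ≤ P a) {x : X} {y : Y} {z : Z} (hx : 0 < P x) (hM : 0 < QM.prob x y)
    (hW : 0 < QW.prob y z) : 0 < ∑ b, ∑ a, P a * QM.prob a b * QW.prob b z :=
  Finset.sum_pos' (fun b _ => Finset.sum_nonneg fun a _ =>
      mul_nonneg (mul_nonneg (hP a) (QM.nonneg a b)) (QW.nonneg b z))
    ⟨y, Finset.mem_univ y, backward_num_pos QM QW hP hx hM hW⟩

/-- `log P(y|z) - log P(y|x,z)`. -/
def letterDensity (QM : Channel X Y) (QW : Channel Y Z) (P : X → ℝ) (x : X) (y : Y) (z : Z) : ℝ :=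
  Real.log (backwardLaw QM QW P y z)
    + (Real.log (cascade QM QW x z) - Real.log (QM.prob x y) - Real.log (QW.prob y z))

/-- By the Markov chain `X - Y - Z`, `P(y|x,z) = Q_M(y|x) Q_W(z|y) / Q_MW(z|x)`; hence the mean of
the density is `-I(X;Y|Z)`. -/
theorem sum_mul_letterDensity (QM : Channel X Y) (QW : Channel Y Z) {P : X → ℝ}
    (hP : ∀ a, 0 ≤ P a) :
    ∑ a, P a * ∑ b, QM.prob a b * ∑ c, QW.prob b c * letterDensity QM QW P a b c
      = -(condMutualInfo (fun t : X × Y × Z =>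
          P t.1 * QM.prob t.1 t.2.1 * QW.prob t.2.1 t.2.2) * Real.log 2) := by
  rw [condMutualInfo_mul_log_two]
  simp only [Finset.mul_sum, ← Finset.sum_neg_distrib]
  refine Finset.sum_congr rfl fun a _ => Finset.sum_congr rfl fun b _ =>
    Finset.sum_congr rfl fun c _ => ?_
  have hs : ∑ b', P a * QM.prob a b' * QW.prob b' c = P a * cascade QM QW a c := by
    simp only [cascade, Finset.mul_sum, mul_assoc]
  rw [hs]
  rcases (hP a).eq_or_lt with h | hx
  · simp [← h]
  rcases (QM.nonneg a b).eq_or_lt with h | hM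
  · simp [← h]
  rcases (QW.nonneg b c).eq_or_lt with h | hW
  · simp [← h]
  rw [Real.log_mul (by positivity) hW.ne', Real.log_mul hx.ne' hM.ne',
    Real.log_mul hx.ne' (cascade_pos QM QW hM hW).ne']
  unfold letterDensity backwardLaw
  rw [Real.log_div (backward_num_pos QM QW hP hx hM hW).ne'
    (backward_den_pos QM QW hP hx hM hW).ne', Finset.sum_comm (s := (Finset.univ : Finset X))]
  ring

/-- The law of the input letter at position `i`. -/
def inputLaw (π : A → ℝ) (E : A → (ι → X) → ℝ) (i : ι) (a : X) : ℝ :=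
  open Classical in ∑ u, ∑ x, if x i = a then π u * E u x else 0

theorem sum_inputLaw_mul (π : A → ℝ) (E : A → (ι → X) → ℝ) (i : ι) (φ : X → ℝ) :
    ∑ a, inputLaw π E i a * φ a = ∑ u, ∑ x, π u * E u x * φ (x i) := by
  classical
  unfold inputLaw
  simp only [Finset.sum_mul]
  rw [Finset.sum_comm]
  refine Finset.sum_congr rfl fun u _ => ?_
  rw [Finset.sum_comm]
  refine Finset.sum_congr rfl fun x _ => ?_
  simp [ite_mul]

theorem inputLaw_nonneg {π : A → ℝ} {E : A → (ι → X) → ℝ} (hπ : ∀ u, 0 ≤ π u)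
    (hE : ∀ u x, 0 ≤ E u x) (i : ι) (a : X) : 0 ≤ inputLaw π E i a := by
  classical
  refine Finset.sum_nonneg fun u _ => Finset.sum_nonneg fun x _ => ?_
  have := mul_nonneg (hπ u) (hE u x)
  split_ifs <;> first | exact this | exact le_rfl

theorem inputLaw_pos {π : A → ℝ} {E : A → (ι → X) → ℝ} (hπ : ∀ u, 0 ≤ π u)
    (hE : ∀ u x, 0 ≤ E u x) (i : ι) {u : A} {x : ι → X} (h : 0 < π u * E u x) :
    0 < inputLaw π E i (x i) := by
  classical
  have hn : ∀ u x', 0 ≤ if x' i = x i then π u * E u x' else 0 := fun u x' => by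
    have := mul_nonneg (hπ u) (hE u x')
    split_ifs <;> first | exact this | exact le_rfl
  refine Finset.sum_pos' (fun u _ => Finset.sum_nonneg fun x' _ => hn u x')
    ⟨u, Finset.mem_univ u, Finset.sum_pos' (fun x' _ => hn u x')
      ⟨x, Finset.mem_univ x, by simpa using h⟩⟩

theorem inputLaw_mem_stdSimplex {π : A → ℝ} {E : A → (ι → X) → ℝ} (hπ : ∀ u, 0 ≤ π u)
    (hπ1 : ∑ u, π u = 1) (hE : ∀ u x, 0 ≤ E u x) (hE1 : ∀ u, ∑ x, E u x = 1) (i : ι) :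
    inputLaw π E i ∈ stdSimplex ℝ X := by
  refine ⟨inputLaw_nonneg hπ hE i, ?_⟩
  have := sum_inputLaw_mul π E i fun _ => 1
  simp only [mul_one, ← Finset.mul_sum, hE1, hπ1] at this
  exact this

/-- The law of the eavesdropper's observation given the message. -/
def tapLaw (QM : Channel X Y) (QW : Channel Y Z) (E : A → (ι → X) → ℝ) (u : A) (z : ι → Z) : ℝ :=
  ∑ x, E u x * memoryless (cascade QM QW) x z

theorem tapLaw_nonneg (QM : Channel X Y) (QW : Channel Y Z) {E : A → (ι → X) → ℝ}
    (hE : ∀ u x, 0 ≤ E u x) (u : A) (z : ι → Z) : 0 ≤ tapLaw QM QW E u z :=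
  Finset.sum_nonneg fun x _ =>
    mul_nonneg (hE u x) (memoryless_nonneg (cascade_nonneg QM QW) x z)

theorem sum_tapLaw (QM : Channel X Y) (QW : Channel Y Z) {E : A → (ι → X) → ℝ}
    (hE1 : ∀ u, ∑ x, E u x = 1) (u : A) : ∑ z, tapLaw QM QW E u z = 1 := by
  unfold tapLaw
  rw [Finset.sum_comm]
  simp only [← Finset.mul_sum, sum_memoryless (sum_cascade QM QW), mul_one, hE1]

/-- The joint law of message, channel input, channel output and eavesdropper's observation. -/
def systemLaw (QM : Channel X Y) (QW : Channel Y Z) (π : A → ℝ) (E : A → (ι → X) → ℝ)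
    (t : A × (ι → X) × (ι → Y) × (ι → Z)) : ℝ :=
  π t.1 * E t.1 t.2.1 * (memoryless QM.prob t.2.1 t.2.2.1 * memoryless QW.prob t.2.2.1 t.2.2.2)

/-- The measure with which the joint law is compared in the converse. -/
def comparisonLaw (QM : Channel X Y) (QW : Channel Y Z) (π : A → ℝ) (E : A → (ι → X) → ℝ)
    (K : (ι → Y) → A → ℝ) (t : A × (ι → X) × (ι → Y) × (ι → Z)) : ℝ :=
  (π t.1 * E t.1 t.2.1 * memoryless (cascade QM QW) t.2.1 t.2.2.2)
    * ((∏ i, backwardLaw QM QW (inputLaw π E i) (t.2.2.1 i) (t.2.2.2 i)) * K t.2.2.1 t.1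
      * (∑ u, π u * tapLaw QM QW E u t.2.2.2) / (π t.1 * tapLaw QM QW E t.1 t.2.2.2))

variable (QM : Channel X Y) (QW : Channel Y Z) {π : A → ℝ} {E : A → (ι → X) → ℝ}
  {K : (ι → Y) → A → ℝ}

theorem systemLaw_nonneg (hπ : ∀ u, 0 ≤ π u) (hE : ∀ u x, 0 ≤ E u x)
    (t : A × (ι → X) × (ι → Y) × (ι → Z)) : 0 ≤ systemLaw QM QW π E t :=
  mul_nonneg (mul_nonneg (hπ _) (hE _ _))
    (mul_nonneg (memoryless_nonneg QM.nonneg _ _) (memoryless_nonneg QW.nonneg _ _))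

theorem comparisonLaw_nonneg (hπ : ∀ u, 0 ≤ π u) (hE : ∀ u x, 0 ≤ E u x)
    (hK : ∀ y u, 0 ≤ K y u) (t : A × (ι → X) × (ι → Y) × (ι → Z)) :
    0 ≤ comparisonLaw QM QW π E K t :=
  mul_nonneg (mul_nonneg (mul_nonneg (hπ _) (hE _ _))
      (memoryless_nonneg (cascade_nonneg QM QW) _ _))
    (div_nonneg (mul_nonneg (mul_nonneg (Finset.prod_nonneg fun i _ =>
        backwardLaw_nonneg QM QW (inputLaw_nonneg hπ hE i) _ _) (hK _ _))
        (Finset.sum_nonneg fun u _ => mul_nonneg (hπ u) (tapLaw_nonneg QM QW hE u _)))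
      (mul_nonneg (hπ _) (tapLaw_nonneg QM QW hE _ _)))

theorem sum_systemLaw (hπ1 : ∑ u, π u = 1) (hE1 : ∀ u, ∑ x, E u x = 1) :
    ∑ t, systemLaw QM QW π E t = 1 := by
  simp only [Fintype.sum_prod_type, systemLaw, ← Finset.mul_sum, sum_memoryless QM.sum_one,
    sum_memoryless QW.sum_one, mul_one, hE1, hπ1]

/-- Summing out `x` turns the first factor into `π(u) G(z|u)`, with `G` the tap law, and this
cancels the denominator. What remains is `q(z) ∏ P(y_i|z_i) K(y,u)`, with `q` the law of `Z`;
summing over `u`, then `y`, then `z` gives at most 1. -/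
theorem sum_comparisonLaw_le (hπ : ∀ u, 0 ≤ π u) (hπ1 : ∑ u, π u = 1)
    (hE : ∀ u x, 0 ≤ E u x) (hE1 : ∀ u, ∑ x, E u x = 1) (hK : ∀ y u, 0 ≤ K y u)
    (hK1 : ∀ y, ∑ u, K y u ≤ 1) : ∑ t, comparisonLaw QM QW π E K t ≤ 1 := by
  simp only [Fintype.sum_prod_type]
  set q : (ι → Z) → ℝ := fun z => ∑ u, π u * tapLaw QM QW E u z with hq
  have hq0 : ∀ z, 0 ≤ q z := fun z =>
    Finset.sum_nonneg fun u _ => mul_nonneg (hπ u) (tapLaw_nonneg QM QW hE u z)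
  set T : (ι → Y) → (ι → Z) → ℝ := fun y z =>
    ∏ i, backwardLaw QM QW (inputLaw π E i) (y i) (z i) with hT
  have hT0 : ∀ y z, 0 ≤ T y z := fun y z =>
    Finset.prod_nonneg fun i _ => backwardLaw_nonneg QM QW (inputLaw_nonneg hπ hE i) _ _
  calc ∑ u, ∑ x, ∑ y, ∑ z, comparisonLaw QM QW π E K (u, x, y, z)
      = ∑ y, ∑ z, ∑ u, (π u * tapLaw QM QW E u z)
          * (T y z * K y u * q z / (π u * tapLaw QM QW E u z)) := by
        have h1 : ∀ u, ∑ x, ∑ y, ∑ z, comparisonLaw QM QW π E K (u, x, y, z)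
            = ∑ y, ∑ z, ∑ x, comparisonLaw QM QW π E K (u, x, y, z) := fun u => by
          rw [Finset.sum_comm]
          exact Finset.sum_congr rfl fun y _ => Finset.sum_comm
        simp only [h1]
        rw [Finset.sum_comm]
        refine Finset.sum_congr rfl fun y _ => ?_
        rw [Finset.sum_comm]
        refine Finset.sum_congr rfl fun z _ => Finset.sum_congr rfl fun u _ => ?_
        simp only [comparisonLaw]
        rw [← Finset.sum_mul]
        congr 1
        simp only [tapLaw, Finset.mul_sum, mul_assoc]
    _ ≤ ∑ y, ∑ z, ∑ u, T y z * K y u * q z := by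
        refine Finset.sum_le_sum fun y _ => Finset.sum_le_sum fun z _ =>
          Finset.sum_le_sum fun u _ => ?_
        have hb : 0 ≤ T y z * K y u * q z :=
          mul_nonneg (mul_nonneg (hT0 y z) (hK y u)) (hq0 z)
        -- If `π(u) G(z|u) = 0` nothing cancels, but the left side is `0`.
        rcases eq_or_ne (π u * tapLaw QM QW E u z) 0 with h | h
        · rw [h, zero_mul]; exact hb
        · rw [mul_div_cancel₀ _ h]
    _ ≤ ∑ y, ∑ z, T y z * q z := by
        refine Finset.sum_le_sum fun y _ => Finset.sum_le_sum fun z _ => ?_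
        rw [← Finset.sum_mul, ← Finset.mul_sum]
        exact mul_le_mul_of_nonneg_right (mul_le_of_le_one_right (hT0 y z) (hK1 y)) (hq0 z)
    _ ≤ ∑ z, q z := by
        rw [Finset.sum_comm]
        refine Finset.sum_le_sum fun z _ => ?_
        rw [← Finset.sum_mul]
        refine mul_le_of_le_one_left (hq0 z) ?_
        rw [hT, ← Fintype.prod_sum fun i b => backwardLaw QM QW (inputLaw π E i) b (z i)]
        exact Finset.prod_le_one (fun i _ => Finset.sum_nonneg fun b _ =>
          backwardLaw_nonneg QM QW (inputLaw_nonneg hπ hE i) _ _)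
          fun i _ => sum_backwardLaw_le_one _ _ _ _
    _ = 1 := by
        rw [hq, Finset.sum_comm]
        simp only [← Finset.mul_sum, sum_tapLaw QM QW hE1, mul_one, hπ1]

theorem pos_of_memoryless_pos {X Y : Type*} {Q : X → Y → ℝ} (hQ : ∀ a b, 0 ≤ Q a b) {x : ι → X}
    {y : ι → Y} (h : 0 < memoryless Q x y) (i : ι) : 0 < Q (x i) (y i) :=
  (hQ _ _).lt_of_ne fun h0 => h.ne' (Finset.prod_eq_zero (Finset.mem_univ i) h0.symm)

/-- The comparison measure is designed for this identity: the input and encoder factors cancel,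
leaving terms whose means are `-I(X_i;Y_i|Z_i)`, `E log K`, `H(U)` and `-I(U;Z)`. -/
theorem log_comparisonLaw_sub (hπ : ∀ u, 0 ≤ π u) (hE : ∀ u x, 0 ≤ E u x)
    (hK : ∀ y u, 0 < K y u) {u : A} {x : ι → X} {y : ι → Y} {z : ι → Z}
    (h : 0 < systemLaw QM QW π E (u, x, y, z)) :
    0 < comparisonLaw QM QW π E K (u, x, y, z) ∧
    Real.log (comparisonLaw QM QW π E K (u, x, y, z))
        - Real.log (systemLaw QM QW π E (u, x, y, z))
      = ∑ i, letterDensity QM QW (inputLaw π E i) (x i) (y i) (z i) + Real.log (K y u)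
        - Real.log (π u) - (Real.log (tapLaw QM QW E u z)
          - Real.log (∑ u, π u * tapLaw QM QW E u z)) := by
  simp only [systemLaw] at h
  have hMW : 0 ≤ memoryless QM.prob x y * memoryless QW.prob y z :=
    mul_nonneg (memoryless_nonneg QM.nonneg _ _) (memoryless_nonneg QW.nonneg _ _)
  have hπE := pos_of_mul_pos_left h hMW
  have hMW' := pos_of_mul_pos_right h (mul_nonneg (hπ u) (hE u x))
  have hM := pos_of_mul_pos_left hMW' (memoryless_nonneg QW.nonneg _ _)
  have hW := pos_of_mul_pos_right hMW' (memoryless_nonneg QM.nonneg _ _)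
  have hπ0 := pos_of_mul_pos_left hπE (hE u x)
  have hE0 := pos_of_mul_pos_right hπE (hπ u)
  have hMi := pos_of_memoryless_pos QM.nonneg hM
  have hWi := pos_of_memoryless_pos QW.nonneg hW
  have hCi : ∀ i, 0 < cascade QM QW (x i) (z i) := fun i => cascade_pos QM QW (hMi i) (hWi i)
  have hC : 0 < memoryless (cascade QM QW) x z := Finset.prod_pos fun i _ => hCi i
  have hPi : ∀ i, 0 < inputLaw π E i (x i) := fun i => inputLaw_pos hπ hE i hπE
  have hTi : ∀ i, 0 < backwardLaw QM QW (inputLaw π E i) (y i) (z i) := fun i =>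
    div_pos (backward_num_pos QM QW (inputLaw_nonneg hπ hE i) (hPi i) (hMi i) (hWi i))
      (backward_den_pos QM QW (inputLaw_nonneg hπ hE i) (hPi i) (hMi i) (hWi i))
  have hT : 0 < ∏ i, backwardLaw QM QW (inputLaw π E i) (y i) (z i) :=
    Finset.prod_pos fun i _ => hTi i
  have hG : 0 < tapLaw QM QW E u z :=
    Finset.sum_pos' (fun x _ => mul_nonneg (hE u x)
      (memoryless_nonneg (cascade_nonneg QM QW) x z)) ⟨x, Finset.mem_univ x, mul_pos hE0 hC⟩
  have hq : 0 < ∑ u, π u * tapLaw QM QW E u z :=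
    Finset.sum_pos' (fun u _ => mul_nonneg (hπ u) (tapLaw_nonneg QM QW hE u z))
      ⟨u, Finset.mem_univ u, mul_pos hπ0 hG⟩
  have hKu := hK y u
  refine ⟨?_, ?_⟩
  · simp only [comparisonLaw]
    positivity
  · simp only [comparisonLaw, systemLaw]
    rw [Real.log_mul (by positivity) (by positivity), Real.log_mul hπE.ne' hC.ne',
      Real.log_div (by positivity) (by positivity), Real.log_mul (by positivity) hq.ne',
      Real.log_mul hT.ne' hKu.ne', Real.log_mul hπ0.ne' hG.ne', Real.log_mul hπE.ne' hMW'.ne',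
      Real.log_mul hM.ne' hW.ne', Real.log_prod fun i _ => (hTi i).ne']
    simp only [memoryless, letterDensity, Finset.sum_add_distrib, Finset.sum_sub_distrib]
    rw [Real.log_prod fun i _ => (hCi i).ne', Real.log_prod fun i _ => (hMi i).ne',
      Real.log_prod fun i _ => (hWi i).ne']
    ring

/-- Single-letterization: a function of position `i` alone sees only the marginal of `X_i` followed
by the two channels. -/
theorem sum_systemLaw_mul_letter (i : ι) (φ : X → Y → Z → ℝ) :
    ∑ u, ∑ x, ∑ y, ∑ z, systemLaw QM QW π E (u, x, y, z) * φ (x i) (y i) (z i)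
      = ∑ a, inputLaw π E i a * ∑ b, QM.prob a b * ∑ c, QW.prob b c * φ a b c := by
  rw [sum_inputLaw_mul π E i fun a => ∑ b, QM.prob a b * ∑ c, QW.prob b c * φ a b c]
  refine Finset.sum_congr rfl fun u _ => Finset.sum_congr rfl fun x _ => ?_
  simp only [systemLaw, mul_assoc, ← Finset.mul_sum]
  congr 2
  rw [← sum_memoryless_mul_apply QM.sum_one x i fun b => ∑ c, QW.prob b c * φ (x i) b c]
  refine Finset.sum_congr rfl fun y _ => ?_
  rw [sum_memoryless_mul_apply QW.sum_one y i fun c => φ (x i) (y i) c]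

/-- Converse for the degraded wiretap channel: `K` is any (sub-)probability kernel by which the
legitimate receiver guesses the message. -/
theorem wiretap_converse (hπ : ∀ u, 0 ≤ π u) (hπ1 : ∑ u, π u = 1) (hE : ∀ u x, 0 ≤ E u x)
    (hE1 : ∀ u, ∑ x, E u x = 1) (hK : ∀ y u, 0 < K y u) (hK1 : ∀ y, ∑ u, K y u ≤ 1) :
    ∑ u, π u * ∑ x, ∑ y, E u x * memoryless QM.prob x y * Real.log (K y u)
        - ∑ u, π u * Real.log (π u)
      ≤ ∑ u, ∑ z, π u * tapLaw QM QW E u z * (Real.log (tapLaw QM QW E u z)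
          - Real.log (∑ u, π u * tapLaw QM QW E u z))
        + Fintype.card ι * (secrecyCapacity QM QW * Real.log 2) := by
  have hgibbs := sum_mul_log_sub_log_le (systemLaw QM QW π E) (comparisonLaw QM QW π E K)
    (systemLaw_nonneg QM QW hπ hE)
    (comparisonLaw_nonneg QM QW hπ hE fun y u => (hK y u).le)
    fun ⟨u, x, y, z⟩ h => (log_comparisonLaw_sub QM QW hπ hE hK h).1
  -- The true law has mass 1 and the comparison measure at most 1, so the mean log-ratio is at most
  -- 0.
  rw [sum_systemLaw QM QW hπ1 hE1] at hgibbs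
  have hle := sum_comparisonLaw_le QM QW hπ hπ1 hE hE1 (fun y u => (hK y u).le) hK1
  have hexp : ∑ t, systemLaw QM QW π E t * (Real.log (comparisonLaw QM QW π E K t)
        - Real.log (systemLaw QM QW π E t))
      = ∑ u, ∑ x, ∑ y, ∑ z, systemLaw QM QW π E (u, x, y, z) *
        (∑ i, letterDensity QM QW (inputLaw π E i) (x i) (y i) (z i) + Real.log (K y u)
        - Real.log (π u) - (Real.log (tapLaw QM QW E u z)
          - Real.log (∑ u, π u * tapLaw QM QW E u z))) := by
    simp only [Fintype.sum_prod_type]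
    refine Finset.sum_congr rfl fun u _ => Finset.sum_congr rfl fun x _ =>
      Finset.sum_congr rfl fun y _ => Finset.sum_congr rfl fun z _ => ?_
    rcases (systemLaw_nonneg QM QW hπ hE (u, x, y, z)).eq_or_lt with h | h
    · rw [← h, zero_mul, zero_mul]
    · rw [(log_comparisonLaw_sub QM QW hπ hE hK h).2]
  rw [hexp] at hgibbs
  simp only [mul_sub (systemLaw _ _ _ _ _), mul_add, Finset.sum_sub_distrib,
    Finset.sum_add_distrib] at hgibbs
  have h1 : ∑ u, ∑ x, ∑ y, ∑ z, systemLaw QM QW π E (u, x, y, z) *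
        ∑ i, letterDensity QM QW (inputLaw π E i) (x i) (y i) (z i)
      ≥ -(Fintype.card ι * (secrecyCapacity QM QW * Real.log 2)) := by
    have hswap : ∑ u, ∑ x, ∑ y, ∑ z, systemLaw QM QW π E (u, x, y, z) *
        ∑ i, letterDensity QM QW (inputLaw π E i) (x i) (y i) (z i)
        = ∑ i, ∑ u, ∑ x, ∑ y, ∑ z, systemLaw QM QW π E (u, x, y, z) *
          letterDensity QM QW (inputLaw π E i) (x i) (y i) (z i) := by
      simp only [Finset.mul_sum]
      rw [Finset.sum_comm (s := (Finset.univ : Finset ι))]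
      refine Finset.sum_congr rfl fun u _ => ?_
      rw [Finset.sum_comm (s := (Finset.univ : Finset ι))]
      refine Finset.sum_congr rfl fun x _ => ?_
      rw [Finset.sum_comm (s := (Finset.univ : Finset ι))]
      refine Finset.sum_congr rfl fun y _ => ?_
      rw [Finset.sum_comm (s := (Finset.univ : Finset ι))]
    rw [hswap]
    simp only [fun i => sum_systemLaw_mul_letter QM QW (π := π) (E := E) i
        (letterDensity QM QW (inputLaw π E i)),
      fun i => sum_mul_letterDensity QM QW (inputLaw_nonneg hπ hE i), Finset.sum_neg_distrib]
    -- Each `I(X_i;Y_i|Z_i)` is at most `C_s`, since the law of `X_i` is one of the admissible input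
    -- laws.
    refine neg_le_neg ?_
    rw [← nsmul_eq_mul, ← Finset.card_univ, ← Finset.sum_const]
    exact Finset.sum_le_sum fun i _ => mul_le_mul_of_nonneg_right
      (condMutualInfo_le_secrecyCapacity QM QW (inputLaw_mem_stdSimplex hπ hπ1 hE hE1 i))
      (Real.log_nonneg one_le_two)
  have h2 : ∑ u, ∑ x, ∑ y, ∑ z, systemLaw QM QW π E (u, x, y, z) * Real.log (K y u)
      = ∑ u, π u * ∑ x, ∑ y, E u x * memoryless QM.prob x y * Real.log (K y u) := by
    refine Finset.sum_congr rfl fun u _ => ?_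
    rw [Finset.mul_sum]
    refine Finset.sum_congr rfl fun x _ => ?_
    rw [Finset.mul_sum]
    refine Finset.sum_congr rfl fun y _ => ?_
    rw [← Finset.sum_mul]
    simp only [systemLaw, ← Finset.mul_sum, sum_memoryless QW.sum_one]
    ring
  have h3 : ∑ u, ∑ x, ∑ y, ∑ z, systemLaw QM QW π E (u, x, y, z) * Real.log (π u)
      = ∑ u, π u * Real.log (π u) := by
    refine Finset.sum_congr rfl fun u _ => ?_
    simp only [systemLaw, ← Finset.sum_mul, ← Finset.mul_sum, sum_memoryless QW.sum_one,
      sum_memoryless QM.sum_one, hE1, mul_one]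
  -- For a function of `(u, z)`, summing out `y` composes the channels to the cascade, and summing
  -- out `x` gives the tap law.
  have h4 : ∀ ψ : A → (ι → Z) → ℝ,
      ∑ u, ∑ x, ∑ y, ∑ z, systemLaw QM QW π E (u, x, y, z) * ψ u z
      = ∑ u, ∑ z, π u * tapLaw QM QW E u z * ψ u z := fun ψ => by
    refine Finset.sum_congr rfl fun u _ => ?_
    have : ∀ x, ∑ y, ∑ z, systemLaw QM QW π E (u, x, y, z) * ψ u z
        = ∑ z, π u * (E u x * memoryless (cascade QM QW) x z) * ψ u z := fun x => by
      rw [Finset.sum_comm]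
      refine Finset.sum_congr rfl fun z _ => ?_
      rw [← Finset.sum_mul]
      simp only [systemLaw]
      rw [← Finset.mul_sum, sum_memoryless_mul_memoryless]
      ring
    simp only [this]
    rw [Finset.sum_comm]
    refine Finset.sum_congr rfl fun z _ => ?_
    rw [← Finset.sum_mul, ← Finset.mul_sum]
    rfl
  have h5 := h4 fun u z => Real.log (tapLaw QM QW E u z)
  have h6 := h4 fun _ z => Real.log (∑ u, π u * tapLaw QM QW E u z)
  simp only [mul_sub, Finset.sum_sub_distrib]
  linarith

end Converse

end WiretapSI

/-! ### Independent conditioning, flattening of chunks, and the symmetric guessing law. -/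

namespace WiretapSI

/-- Conditioning on an independent variable does not change the mutual information. -/
theorem condMutualInfo_of_indep {A B C : Type*} [Fintype A] [Fintype B] [Fintype C]
    {q : A → B → ℝ} {r : C → ℝ} (hq : ∀ a b, 0 ≤ q a b) (hr : ∀ c, 0 ≤ r c)
    (hq1 : ∑ a, ∑ b, q a b = 1) (hr1 : ∑ c, r c = 1) :
    condMutualInfo (fun t : A × B × C => q t.1 t.2.1 * r t.2.2) * Real.log 2
      = ∑ a, ∑ b, q a b *
        (Real.log (q a b) - Real.log (∑ b', q a b') - Real.log (∑ a', q a' b)) := by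
  rw [condMutualInfo_mul_log_two]
  simp only [← Finset.sum_mul, hq1, one_mul]
  refine Finset.sum_congr rfl fun a _ => Finset.sum_congr rfl fun b _ => ?_
  rw [← mul_one (q a b * _), ← hr1, Finset.mul_sum]
  refine Finset.sum_congr rfl fun c _ => ?_
  rcases (hq a b).eq_or_lt with h | h
  · simp [← h]
  rcases (hr c).eq_or_lt with h' | h'
  · simp [← h']
  have h1 : 0 < ∑ b', q a b' := Finset.sum_pos' (fun b _ => hq a b) ⟨b, Finset.mem_univ b, h⟩
  have h2 : 0 < ∑ a', q a' b := Finset.sum_pos' (fun a _ => hq a b) ⟨a, Finset.mem_univ a, h⟩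
  rw [Real.log_mul h.ne' h'.ne', Real.log_mul h1.ne' h'.ne', Real.log_mul h2.ne' h'.ne']
  ring

/-- Translates between the system, written in chunks, and the converse, stated for a single index
set. -/
theorem sum_curry {ι κ B : Type*} [Fintype ι] [DecidableEq ι] [Fintype κ] [DecidableEq κ]
    [Fintype B] (F : (ι → κ → B) → ℝ) :
    ∑ x : ι × κ → B, F (Function.curry x) = ∑ x : ι → κ → B, F x :=
  (Equiv.curry ι κ B).sum_comp F

theorem memoryless_curry {ι κ X Y : Type*} [Fintype ι] [Fintype κ] (Q : X → Y → ℝ)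
    (x : ι × κ → X) (y : ι × κ → Y) :
    memoryless (memoryless Q) (Function.curry x) (Function.curry y) = memoryless Q x y := by
  simp only [memoryless, Fintype.prod_prod_type, Function.curry]

noncomputable section Fano

set_option linter.unusedSectionVars false

/-- The output law of a symmetric channel with error probability `ε`. -/
def symmetricLaw {U : Type*} [Fintype U] [DecidableEq U] (ε : ℝ) (v u : U) : ℝ :=
  if v ≠ u then ε / ((Fintype.card U : ℝ) - 1) else 1 - ε

variable {U : Type*} [Fintype U] [DecidableEq U] {ε : ℝ}

theorem symmetricLaw_pos (hU : 2 ≤ Fintype.card U) (h0 : 0 < ε) (h1 : ε < 1) (v u : U) :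
    0 < symmetricLaw ε v u := by
  have : (2 : ℝ) ≤ Fintype.card U := by exact_mod_cast hU
  unfold symmetricLaw
  split_ifs
  · exact div_pos h0 (by linarith)
  · linarith

theorem sum_symmetricLaw (hU : 2 ≤ Fintype.card U) (v : U) : ∑ u, symmetricLaw ε v u = 1 := by
  have h2 : (2 : ℝ) ≤ Fintype.card U := by exact_mod_cast hU
  rw [← Finset.add_sum_erase _ _ (Finset.mem_univ v)]
  have : ∀ u ∈ Finset.univ.erase v, symmetricLaw ε v u = ε / ((Fintype.card U : ℝ) - 1) :=
    fun u hu => if_pos (Finset.ne_of_mem_erase hu).symm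
  rw [Finset.sum_congr rfl this, Finset.sum_const, Finset.card_erase_of_mem (Finset.mem_univ v),
    Finset.card_univ, nsmul_eq_mul, Nat.cast_sub (by omega), Nat.cast_one,
    mul_div_cancel₀ _ (by linarith)]
  simp [symmetricLaw]

/-- Affine in the error indicator, so expectations involve only the error probability and no
concavity argument is needed. -/
theorem log_symmetricLaw (v u : U) :
    Real.log (symmetricLaw ε v u) = Real.log (1 - ε)
      - (if v ≠ u then 1 else 0)
        * (Real.log (1 - ε) - Real.log (ε / ((Fintype.card U : ℝ) - 1))) := by
  unfold symmetricLaw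
  split_ifs <;> ring

/-- The condition `ε ≤ 1 - 1/α` says exactly that a wrong letter is no likelier than the right one.
The sign is what lets an upper bound on errors bound `E log K` from below. -/
theorem log_symmetricLaw_gap_nonneg (hU : 2 ≤ Fintype.card U) (h0 : 0 < ε)
    (h1 : ε ≤ 1 - 1 / (Fintype.card U : ℝ)) :
    0 ≤ Real.log (1 - ε) - Real.log (ε / ((Fintype.card U : ℝ) - 1)) := by
  have h2 : (2 : ℝ) ≤ Fintype.card U := by exact_mod_cast hU
  have h3 : (0 : ℝ) < (Fintype.card U : ℝ) - 1 := by linarith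
  refine sub_nonneg.2 (Real.log_le_log (div_pos h0 h3) ?_)
  rw [div_le_iff₀ h3]
  have h4 : ε * Fintype.card U ≤ (1 - 1 / (Fintype.card U : ℝ)) * Fintype.card U :=
    mul_le_mul_of_nonneg_right h1 (by linarith)
  have h5 : (1 - 1 / (Fintype.card U : ℝ)) * Fintype.card U = Fintype.card U - 1 := by
    field_simp
  linarith

theorem fanoTerm_mul_log_two (hU : 2 ≤ Fintype.card U) (h0 : 0 < ε) (h1 : ε < 1) :
    fanoTerm (Fintype.card U) ε * Real.log 2
      = -(Real.log (1 - ε)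
        - ε * (Real.log (1 - ε) - Real.log (ε / ((Fintype.card U : ℝ) - 1)))) := by
  have h2 : (2 : ℝ) ≤ Fintype.card U := by exact_mod_cast hU
  have hl : Real.log 2 ≠ 0 := (Real.log_pos one_lt_two).ne'
  rw [Real.log_div h0.ne' (by linarith), fanoTerm, Real.logb,
    Real.binEntropy_eq_negMulLog_add_negMulLog_one_sub, Real.negMulLog, Real.negMulLog]
  field_simp
  ring

end Fano

/-! ### Reliability and security of the finite-state system. -/

namespace System

noncomputable section

set_option linter.unusedSectionVars false

variable {U W X Y Z Wd Se Sd : Type*} [Fintype U] [DecidableEq U] [Fintype W] [Fintype X]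
  [Fintype Y] [Fintype Z] [Fintype Wd] {k m b : ℕ} (S : System U W X Y Se Sd k m)

/-- The state of the decoder before chunk `i`, when it starts in state `d`. -/
def decState (w : Fin b → Fin k → W) (d : Sd) (y : Fin b → Fin m → Y) : ℕ → Sd
  | 0 => d
  | i + 1 => if h : i < b then S.decNext (y ⟨i, h⟩) (w ⟨i, h⟩) (decState w d y i)
      else decState w d y i

/-- Causality: the state before chunk `i` depends only on earlier outputs, so resampling chunk `i`
leaves it fixed. -/
theorem decState_update (w : Fin b → Fin k → W) (d : Sd) (y : Fin b → Fin m → Y) (i : Fin b)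
    (c : Fin m → Y) {j : ℕ} (hj : j ≤ i) :
    S.decState w d (Function.update y i c) j = S.decState w d y j := by
  induction j with
  | zero => rfl
  | succ j ih =>
    have hji : j < (i : ℕ) := hj
    have hne : (⟨j, hji.trans i.2⟩ : Fin b) ≠ i := fun h => hji.ne (congrArg Fin.val h)
    simp only [decState, ih hji.le, hji.trans i.2, dif_pos, Function.update_of_ne hne]

/-- The reconstruction of chunk `i`. -/
def decoded (w : Fin b → Fin k → W) (d : Sd) (y : Fin b → Fin m → Y) (i : Fin b) : Fin k → U :=
  S.dec (y i) (w i) (S.decState w d y i)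

/-- The law of the output chunk `i` of the main channel. -/
def chunkLaw (QM : Channel X Y) (u : Fin b → Fin k → U) (w : Fin b → Fin k → W) (i : Fin b)
    (y : Fin m → Y) : ℝ :=
  ∑ x, S.enc.prob (u i, w i, S.encState u w i) x * memoryless QM.prob x y

theorem chunkLaw_nonneg (QM : Channel X Y) (u : Fin b → Fin k → U) (w : Fin b → Fin k → W)
    (i : Fin b) (y : Fin m → Y) : 0 ≤ S.chunkLaw QM u w i y :=
  Finset.sum_nonneg fun x _ =>
    mul_nonneg (S.enc.nonneg _ x) (memoryless_nonneg QM.nonneg x y)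

theorem sum_chunkLaw (QM : Channel X Y) (u : Fin b → Fin k → U) (w : Fin b → Fin k → W)
    (i : Fin b) : ∑ y, S.chunkLaw QM u w i y = 1 := by
  unfold chunkLaw
  rw [Finset.sum_comm]
  simp only [← Finset.mul_sum, sum_memoryless QM.sum_one, mul_one, S.enc.sum_one]

theorem encLaw_nonneg (u : Fin b → Fin k → U) (w : Fin b → Fin k → W) (x : Fin b → Fin m → X) :
    0 ≤ S.encLaw u w x :=
  Finset.prod_nonneg fun _ _ => S.enc.nonneg _ _

theorem sum_encLaw (u : Fin b → Fin k → U) (w : Fin b → Fin k → W) :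
    ∑ x, S.encLaw u w x = 1 :=
  sum_prod_eq_one (fun i => S.enc.prob (u i, w i, S.encState u w i)) fun _ => S.enc.sum_one _

theorem sum_encLaw_mul_memoryless (QM : Channel X Y) (u : Fin b → Fin k → U)
    (w : Fin b → Fin k → W) (y : Fin b → Fin m → Y) :
    ∑ x, S.encLaw u w x * memoryless (memoryless QM.prob) x y
      = ∏ i, S.chunkLaw QM u w i (y i) := by
  simp only [chunkLaw]
  rw [Fintype.prod_sum]
  refine Finset.sum_congr rfl fun x _ => ?_
  rw [Finset.prod_mul_distrib]
  rfl

/-- For fixed inputs the encoder states are deterministic, so the output chunks are independent.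
Given the other chunks, the decoder state at `i` is fixed, and reliability applies because it holds
for every pair of initial states. -/
theorem sum_chunkLaw_mul_errors_le (hk : 0 < k) (QM : Channel X Y) {εr : ℝ}
    (hS : S.Reliable QM εr) (u : Fin b → Fin k → U) (w : Fin b → Fin k → W) (d : Sd) (i : Fin b) :
    ∑ y : Fin b → Fin m → Y, (∏ i, S.chunkLaw QM u w i (y i)) *
      (∑ j, if S.decoded w d y i j ≠ u i j then (1 : ℝ) else 0) ≤ k * εr := by
  refine sum_prod_mul_le (S.chunkLaw QM u w) (S.chunkLaw_nonneg QM u w) (S.sum_chunkLaw QM u w) i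
    (fun y => ∑ j, if S.decoded w d y i j ≠ u i j then (1 : ℝ) else 0) _ fun y => ?_
  have hk' : (0 : ℝ) < k := by exact_mod_cast hk
  have h := hS (u i) (w i) (S.encState u w i) (S.decState w d y i)
  unfold bitErrorProb at h
  rw [one_div, inv_mul_le_iff₀ hk'] at h
  refine le_trans (le_of_eq ?_) h
  simp only [decoded, Function.update_self, S.decState_update w d y i _ le_rfl, chunkLaw,
    Finset.mul_sum, Finset.sum_mul]
  rw [Finset.sum_comm]
  refine Finset.sum_congr rfl fun j _ => ?_
  rw [Finset.sum_comm]
  refine Finset.sum_congr rfl fun x _ => Finset.sum_congr rfl fun y' _ => ?_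
  rw [mul_ite, mul_one, mul_zero]

/-- The kernel by which the receiver guesses the source sequence around its reconstruction. -/
def guessKernel (ε : ℝ) (w : Fin b → Fin k → W) (d : Sd) (y : Fin b → Fin m → Y)
    (u : Fin b → Fin k → U) : ℝ :=
  ∏ i, ∏ j, symmetricLaw ε (S.decoded w d y i j) (u i j)

theorem sum_guessKernel {ε : ℝ} (hU : 2 ≤ Fintype.card U) (w : Fin b → Fin k → W) (d : Sd)
    (y : Fin b → Fin m → Y) : ∑ u, S.guessKernel ε w d y u = 1 :=
  sum_prod_eq_one (fun i (ui : Fin k → U) => ∏ j, symmetricLaw ε (S.decoded w d y i j) (ui j))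
    fun i => sum_prod_eq_one (fun j => symmetricLaw ε (S.decoded w d y i j))
      fun _ => sum_symmetricLaw hU _

theorem fano_le (hk : 0 < k) (QM : Channel X Y) {εr : ℝ} (hU : 2 ≤ Fintype.card U)
    (h0 : 0 < εr) (h1 : εr ≤ 1 - 1 / (Fintype.card U : ℝ)) (h1' : εr < 1)
    (hS : S.Reliable QM εr) (u : Fin b → Fin k → U) (w : Fin b → Fin k → W) (d : Sd) :
    -(b * k * (fanoTerm (Fintype.card U) εr * Real.log 2))
      ≤ ∑ y : Fin b → Fin m → Y, (∏ i, S.chunkLaw QM u w i (y i))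
        * Real.log (S.guessKernel εr w d y u) := by
  set a := Real.log (1 - εr)
  set g := Real.log (1 - εr) - Real.log (εr / ((Fintype.card U : ℝ) - 1))
  have hg : 0 ≤ g := log_symmetricLaw_gap_nonneg hU h0 h1
  have hlog : ∀ y : Fin b → Fin m → Y, Real.log (S.guessKernel εr w d y u)
      = b * k * a - ∑ i, (∑ j, if S.decoded w d y i j ≠ u i j then (1 : ℝ) else 0) * g := by
    intro y
    have hp := symmetricLaw_pos (U := U) hU h0 h1'
    rw [guessKernel, Real.log_prod fun i _ => (Finset.prod_pos fun j _ => hp _ _).ne']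
    have : ∀ i, Real.log (∏ j, symmetricLaw εr (S.decoded w d y i j) (u i j))
        = k * a - (∑ j, if S.decoded w d y i j ≠ u i j then (1 : ℝ) else 0) * g := by
      intro i
      rw [Real.log_prod fun j _ => (hp _ _).ne']
      simp only [log_symmetricLaw, Finset.sum_sub_distrib, Finset.sum_mul]
      simp [a, g]
    simp only [this, Finset.sum_sub_distrib]
    simp [mul_assoc]
  have hsum : ∑ y : Fin b → Fin m → Y, (∏ i, S.chunkLaw QM u w i (y i))
        * Real.log (S.guessKernel εr w d y u)
      = b * k * a - ∑ i, (∑ y : Fin b → Fin m → Y, (∏ i, S.chunkLaw QM u w i (y i))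
        * (∑ j, if S.decoded w d y i j ≠ u i j then (1 : ℝ) else 0)) * g := by
    simp only [hlog, mul_sub, Finset.sum_sub_distrib]
    rw [← Finset.sum_mul, sum_prod_eq_one _ (S.sum_chunkLaw QM u w), one_mul]
    congr 1
    simp only [Finset.sum_mul _ (fun y : Fin b → Fin m → Y => _) g]
    rw [Finset.sum_comm]
    refine Finset.sum_congr rfl fun y _ => ?_
    rw [Finset.mul_sum]
    exact Finset.sum_congr rfl fun i _ => (mul_assoc _ _ _).symm
  have hle : ∑ i, (∑ y : Fin b → Fin m → Y, (∏ i, S.chunkLaw QM u w i (y i))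
        * (∑ j, if S.decoded w d y i j ≠ u i j then (1 : ℝ) else 0)) * g
      ≤ ∑ _i : Fin b, (k * εr) * g :=
    Finset.sum_le_sum fun i _ => mul_le_mul_of_nonneg_right
      (S.sum_chunkLaw_mul_errors_le hk QM hS u w d i) hg
  rw [Finset.sum_const, Finset.card_univ, Fintype.card_fin, nsmul_eq_mul] at hle
  rw [hsum, fanoTerm_mul_log_two hU h0 h1']
  linarith [show -((b : ℝ) * k * -(a - εr * g)) = b * k * a - b * (k * εr * g) by ring]

/-- The leakage to the eavesdropper when the source is uniform and the side information is
constant. -/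
theorem condMutualInfo_jointLaw_uniform [DecidableEq W] (QM : Channel X Y)
    (QW : Channel Y Z) (QL : Channel W Wd) (w : Fin b → Fin k → W) (p : ℝ) (hp : 0 < p)
    (hp1 : ∑ _u : Fin b → Fin k → U, p = 1) :
    condMutualInfo (S.jointLaw QM QW QL
        (fun t : (Fin b → Fin k → U) × (Fin b → Fin k → W) => if t.2 = w then p else 0))
        * Real.log 2
      = ∑ u, ∑ z, p * S.wiretapLaw QM QW u w z * (Real.log (S.wiretapLaw QM QW u w z)
          - Real.log (∑ u, p * S.wiretapLaw QM QW u w z)) := by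
  have hG0 : ∀ u z, 0 ≤ S.wiretapLaw QM QW u w z := fun u z =>
    Finset.sum_nonneg fun x _ => mul_nonneg (S.encLaw_nonneg u w x)
      (memoryless_nonneg (memoryless_nonneg (cascade_nonneg QM QW)) x z)
  have hG1 : ∀ u, ∑ z, S.wiretapLaw QM QW u w z = 1 := fun u => by
    unfold wiretapLaw
    rw [Finset.sum_comm]
    simp only [← Finset.mul_sum, sum_memoryless (sum_memoryless (sum_cascade QM QW)), mul_one,
      S.sum_encLaw]
  have hlaw : S.jointLaw QM QW QL
      (fun t : (Fin b → Fin k → U) × (Fin b → Fin k → W) => if t.2 = w then p else 0)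
      = fun t => (p * S.wiretapLaw QM QW t.1 w t.2.1)
        * memoryless (memoryless QL.prob) w t.2.2 := by
    -- Fixing `w` collapses the sum over side information, and the law factors into `(U,Z)` times
    -- the leakage output.
    funext t
    simp only [jointLaw, ite_mul, zero_mul, Finset.sum_ite_eq',
      Finset.mem_univ, if_true]
    ring
  rw [hlaw, condMutualInfo_of_indep (q := fun u z => p * S.wiretapLaw QM QW u w z)
    (r := fun v => memoryless (memoryless QL.prob) w v)
    (fun u z => mul_nonneg hp.le (hG0 u z))
    (memoryless_nonneg (memoryless_nonneg QL.nonneg) w)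
    (by simp only [← Finset.mul_sum, hG1, mul_one]; exact hp1)
    (sum_memoryless (sum_memoryless QL.sum_one) w)]
  refine Finset.sum_congr rfl fun u _ => Finset.sum_congr rfl fun z _ => ?_
  rcases (hG0 u z).eq_or_lt with h | h
  · simp [← h]
  rw [← Finset.mul_sum, hG1, mul_one, Real.log_mul hp.ne' h.ne']
  ring

/-- Reliability and security bound the secrecy capacity from below by the source entropy rate of a
uniform source. -/
theorem logb_card_le [Nonempty W] [DecidableEq W] [Nonempty Sd] (hk : 0 < k)
    (QM : Channel X Y) (QW : Channel Y Z) (QL : Channel W Wd) {εr εs : ℝ}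
    (hU : 2 ≤ Fintype.card U) (h0 : 0 < εr) (h1 : εr ≤ 1 - 1 / (Fintype.card U : ℝ))
    (hS : S.Reliable QM εr) (hsec : S.Secure QM QW QL εs) :
    Real.logb 2 (Fintype.card U) - fanoTerm (Fintype.card U) εr - εs
      ≤ ((m : ℝ) / k) * secrecyCapacity QM QW := by
  have h2 : (2 : ℝ) ≤ Fintype.card U := by exact_mod_cast hU
  have hl : 0 < Real.log 2 := Real.log_pos one_lt_two
  have h1' : εr < 1 := by
    have : 0 < 1 / (Fintype.card U : ℝ) := by positivity
    linarith
  have : Nonempty U := Fintype.card_pos_iff.1 (by omega)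
  -- One positive block count suffices: every term of the final inequality is proportional to `b`,
  -- so no limit is taken.
  obtain ⟨b, hb, hb0⟩ := (hsec.and (eventually_gt_atTop 0)).exists
  obtain ⟨w0⟩ := ‹Nonempty W›
  obtain ⟨d⟩ := ‹Nonempty Sd›
  set w : Fin b → Fin k → W := fun _ _ => w0
  set M : ℕ := Fintype.card (Fin b → Fin k → U) with hM
  have hM0 : (0 : ℝ) < M := by
    exact_mod_cast (Fintype.card_pos : 0 < Fintype.card (Fin b → Fin k → U))
  set p : ℝ := (M : ℝ)⁻¹ with hp
  have hp0 : 0 < p := inv_pos.2 hM0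
  have hp1 : ∑ _u : Fin b → Fin k → U, p = 1 := by
    rw [Finset.sum_const, Finset.card_univ, nsmul_eq_mul, ← hM, hp, mul_inv_cancel₀ hM0.ne']
  have hlogM : Real.log M = b * k * Real.log (Fintype.card U) := by
    have : M = (Fintype.card U ^ k) ^ b := by simp [hM]
    rw [this]
    push_cast
    rw [Real.log_pow, Real.log_pow]
    ring
  have hleak := hb (fun t => if t.2 = w then p else 0) (by
    refine ⟨fun t => ?_, ?_⟩
    · dsimp only
      split_ifs
      · exact hp0.le
      · exact le_rfl
    · rw [Fintype.sum_prod_type]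
      simpa using hp1)
  replace hleak := mul_le_mul_of_nonneg_right hleak hl.le
  rw [S.condMutualInfo_jointLaw_uniform QM QW QL w p hp0 hp1] at hleak
  -- The message is the whole source block, and the channel uses are indexed by pairs (chunk,
  -- position).
  have hconv := wiretap_converse (A := Fin b → Fin k → U) (ι := Fin b × Fin m) QM QW
    (π := fun _ => p) (E := fun u x => S.encLaw u w (Function.curry x))
    (K := fun y u => S.guessKernel εr w d (Function.curry y) u)
    (fun _ => hp0.le) hp1 (fun u x => S.encLaw_nonneg u w _)
    (fun u => by rw [sum_curry fun x => S.encLaw u w x, S.sum_encLaw])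
    (fun y u => Finset.prod_pos fun i _ => Finset.prod_pos fun j _ =>
      symmetricLaw_pos hU h0 h1' _ _)
    (fun y => (S.sum_guessKernel hU w d _).le)
  have htap : ∀ u (z : Fin b × Fin m → Z),
      tapLaw QM QW (fun u x => S.encLaw u w (Function.curry x)) u z
        = S.wiretapLaw QM QW u w (Function.curry z) := fun u z => by
    simp only [tapLaw, ← memoryless_curry]
    exact sum_curry fun x => S.encLaw u w x
      * memoryless (memoryless (cascade QM QW)) x (Function.curry z)
  have hfano : ∀ u, -(b * k * (fanoTerm (Fintype.card U) εr * Real.log 2))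
      ≤ ∑ x : Fin b × Fin m → X, ∑ y : Fin b × Fin m → Y,
        S.encLaw u w (Function.curry x) * memoryless QM.prob x y
          * Real.log (S.guessKernel εr w d (Function.curry y) u) := fun u => by
    refine (S.fano_le hk QM hU h0 h1 h1' hS u w d).trans (le_of_eq ?_)
    simp only [← memoryless_curry]
    rw [Finset.sum_comm, ← sum_curry]
    refine Finset.sum_congr rfl fun y _ => ?_
    rw [← S.sum_encLaw_mul_memoryless, ← Finset.sum_mul,
      ← sum_curry fun x => S.encLaw u w x
        * memoryless (memoryless QM.prob) x (Function.curry y)]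
  have hfano' := Finset.sum_le_sum fun u (_ : u ∈ (Finset.univ : Finset (Fin b → Fin k → U))) =>
    mul_le_mul_of_nonneg_left (hfano u) hp0.le
  rw [← Finset.sum_mul, hp1, one_mul] at hfano'
  have hz : ∀ u, ∑ z : Fin b × Fin m → Z, p * S.wiretapLaw QM QW u w (Function.curry z) *
        (Real.log (S.wiretapLaw QM QW u w (Function.curry z))
          - Real.log (∑ u, p * S.wiretapLaw QM QW u w (Function.curry z)))
      = ∑ z, p * S.wiretapLaw QM QW u w z * (Real.log (S.wiretapLaw QM QW u w z)
          - Real.log (∑ u, p * S.wiretapLaw QM QW u w z)) := fun u =>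
    sum_curry fun z => p * S.wiretapLaw QM QW u w z * (Real.log (S.wiretapLaw QM QW u w z)
          - Real.log (∑ u, p * S.wiretapLaw QM QW u w z))
  have hent : ∑ _u : Fin b → Fin k → U, p * Real.log p = -Real.log M := by
    rw [← Finset.sum_mul, hp1, one_mul, hp, Real.log_inv]
  simp only [htap, hz, hent, Fintype.card_prod, Fintype.card_fin] at hconv
  push_cast at hconv hleak
  rw [hlogM] at hconv
  have hb' : (0 : ℝ) < b := by exact_mod_cast hb0
  have hk' : (0 : ℝ) < k := by exact_mod_cast hk
  have hlogb : Real.log (Fintype.card U) = Real.logb 2 (Fintype.card U) * Real.log 2 := by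
    rw [Real.logb, div_mul_cancel₀ _ hl.ne']
  rw [hlogb] at hconv
  rw [div_mul_eq_mul_div, le_div_iff₀ hk']
  refine le_of_mul_le_mul_right ?_ (mul_pos hb' hl)
  linarith

end

end System

end WiretapSI

/-! ### Assembly of the bound. -/

theorem theorem3 (U W : Type*) [Fintype U] [DecidableEq U] [Fintype W] [DecidableEq W] :
    ∃ ε : ℕ → ℝ, Tendsto ε atTop (𝓝 0) ∧ (∀ n, ε n < 1) ∧
      ∀ (X Y Z Wd Se Sd : Type*) [Fintype X] [Fintype Y] [Fintype Z] [Fintype Wd]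
        [Fintype Se] [Fintype Sd] [Nonempty Sd]
        (QM : Channel X Y) (QW : Channel Y Z) (QL : Channel W Wd)
        (k m : ℕ) (_ : 0 < k) (_ : 0 < m) (S : System U W X Y Se Sd k m)
        (εr εs : ℝ) (_ : 0 < εr) (_ : εr ≤ 1 - 1 / (Fintype.card U : ℝ)) (_ : 0 < εs)
        (_ : S.Reliable QM εr) (_ : S.Secure QM QW QL εs)
        (n : ℕ) (_ : 0 < n) (_ : k ∣ n) (u : Fin n → U) (w : Fin n → W),
        condLZ u w - fanoTerm (Fintype.card U) εr - εs
            - redundancy (Fintype.card U) (Fintype.card W) (ε n) n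
                (Fintype.card Se * Fintype.card Sd) k
          ≤ ((m : ℝ) / k) * secrecyCapacity QM QW
        ∧ (0 < secrecyCapacity QM QW →
          (m : ℝ) / k ≥
            (condLZ u w - fanoTerm (Fintype.card U) εr - εs
              - redundancy (Fintype.card U) (Fintype.card W) (ε n) n
                  (Fintype.card Se * Fintype.card Sd) k) / secrecyCapacity QM QW) := by
  -- With `ε_n = 0` every term of the redundancy is nonnegative, so subtracting it only weakens the
  -- bound.
  refine ⟨fun _ => 0, tendsto_const_nhds, fun _ => one_pos, ?_⟩
  intro X Y Z Wd Se Sd _ _ _ _ _ _ _ QM QW QL k m hk _ S εr εs h0 h1 _ hS hsec n hn _ u w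
  have : Nonempty W := ⟨w ⟨0, hn⟩⟩
  have hU0 : 0 < Fintype.card U := Fintype.card_pos_iff.2 ⟨u ⟨0, hn⟩⟩
  -- A one-letter alphabet would force `ε_r ≤ 0`.
  have hU : 2 ≤ Fintype.card U := by
    by_contra h
    have hU1 : Fintype.card U = 1 := by omega
    rw [hU1] at h1
    norm_num at h1
    linarith
  have hUW : 2 ≤ Fintype.card U * Fintype.card W :=
    hU.trans (Nat.le_mul_of_pos_right _ Fintype.card_pos)
  have hmain := S.logb_card_le hk QM QW QL hU h0 h1 hS hsec
  have hLZ := condLZ_le_logb_card hn u w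
  have hη := redundancy_nonneg hUW n (Fintype.card Se * Fintype.card Sd) k
  have hbound : condLZ u w - fanoTerm (Fintype.card U) εr - εs
      - redundancy (Fintype.card U) (Fintype.card W) 0 n (Fintype.card Se * Fintype.card Sd) k
      ≤ ((m : ℝ) / k) * secrecyCapacity QM QW := by linarith
  exact ⟨hbound, fun hC => (div_le_iff₀ hC).2 hbound⟩
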